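/- Let $k$ be an algebraically closed field and let $n\ge 0$. Let $\alpha=(\alpha_1\ge\alpha_2\ge\cdots)$ and $\beta=(\beta_1\ge\beta_2\ge\cdots)$ be partitions of $n$, extended by zeros. Let $\mathbb M_n^0(k)$ be the set of nilpotent $n\times n$ matrices over $k$, with the topology induced by the Zariski topology of the affine space $\mathbb M_n(k)$ of all $n\times n$ matrices. The group $GL_n(k)$ acts on $\mathbb M_n^0(k)$ by conjugation $g\cdot A=gAg^{-1}$. Let $G_\alpha$ denote the orbit of the nilpotent matrix $N_\alpha$ of Jordan type $\alpha$, i.e. the block diagonal matrix with nilpotent Jordan blocks of sizes $\alpha_1,\alpha_2,\dots$. Write $N_\alpha\le_{\rm deg}N_\beta$ if $G_\beta\subseteq\overline{G_\alpha}$, the closure being taken in $\mathbb M_n^0(k)$. For partitions $\alpha,\beta$ of $n$ write $\alpha\mapsto_{\rm box}\beta$ if there exist indices $i<j$ such that $\alpha_i=\beta_i+1$, $\alpha_j=\beta_j-1$ and $\alpha_l=\beta_l$ for all $l\ne i,j$. Let $\le_{\rm box}$ be the partial order on the partitions of $n$ generated by these moves, i.e. the reflexive and transitive closure of $\mapsto_{\rm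 box}$. Theorem. For all partitions $\alpha,\beta$ of $n$, $$N_\alpha\le_{\rm deg}N_\beta\quad\Longleftrightarrow\quad \alpha\le_{\rm box}\beta .$$ -/

import Mathlib

/-! ### Partitions and the box order -/

/-- The `i`-th part of a partition (indexed from `0`), the parts being listed in
weakly decreasing order and followed by infinitely many zeros. -/
def partitionPart {n : ℕ} (α : n.Partition) (i : ℕ) : ℕ :=
  (α.parts.sort (· ≥ ·)).getD i 0

/-- A single box move `α ↦ β`: for some `i < j` one has `α_i = β_i + 1`,
`α_j = β_j - 1` (written without subtraction), and all other parts agree. -/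
def BoxMove {n : ℕ} (α β : n.Partition) : Prop :=
  ∃ i j : ℕ, i < j ∧
    partitionPart α i = partitionPart β i + 1 ∧
    partitionPart α j + 1 = partitionPart β j ∧
    ∀ l : ℕ, l ≠ i → l ≠ j → partitionPart α l = partitionPart β l

/-- The box order: the reflexive and transitive closure of the box moves
between partitions of `n`. -/
def BoxLE {n : ℕ} (α β : n.Partition) : Prop :=
  Relation.ReflTransGen BoxMove α β

theorem list_sum_getD (L : List ℕ) (m : ℕ) (h : L.length ≤ m) :
    ∑ i : Fin m, L.getD i 0 = L.sum := by
  induction L generalizing m with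
  | nil => simp
  | cons a L ih =>
    obtain _ | m := m
    · simp at h
    · rw [Fin.sum_univ_succ]
      simp only [List.length_cons, Nat.add_le_add_iff_right] at h
      simpa using ih m h

theorem list_length_le_sum (L : List ℕ) (h : ∀ x ∈ L, 0 < x) : L.length ≤ L.sum := by
  induction L with
  | nil => simp
  | cons a L ih =>
    have h1 := ih (fun x hx => h x (List.mem_cons_of_mem _ hx))
    have h2 := h a List.mem_cons_self
    simp only [List.length_cons, List.sum_cons]
    omega

/-- The parts of a partition of `n` with index less than `n` (zeros allowed) add up to `n`. -/
theorem sum_partitionPart {n : ℕ} (α : n.Partition) :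
    ∑ i : Fin n, partitionPart α i = n := by
  have hs : (α.parts.sort (· ≥ ·)).sum = n := by
    rw [← Multiset.sum_coe, Multiset.sort_eq, α.parts_sum]
  have hl : (α.parts.sort (· ≥ ·)).length ≤ n := by
    refine (list_length_le_sum _ ?_).trans hs.le
    intro x hx
    exact α.parts_pos (by simpa using hx)
  exact (list_sum_getD _ n hl).trans hs

/-! ### The variety of nilpotent matrices -/

/-- The Zariski topology on the affine space of `n × n` matrices: the closed sets are the
common zero sets of families of polynomials in the `n ^ 2` matrix entries. -/
abbrev zariskiTopology (k : Type*) [Field k] (n : ℕ) :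
    TopologicalSpace (Matrix (Fin n) (Fin n) k) :=
  TopologicalSpace.ofClosed
    {Z | ∃ S : Set (MvPolynomial (Fin n × Fin n) k),
      Z = {A | ∀ p ∈ S, MvPolynomial.eval (fun x => A x.1 x.2) p = 0}}
    ⟨{1}, by ext A; simp⟩
    (by
      intro F hF
      refine ⟨{p | ∃ Z ∈ F, ∀ A ∈ Z, MvPolynomial.eval (fun x => A x.1 x.2) p = 0}, ?_⟩
      ext A
      constructor
      · rintro hA p ⟨Z, hZ, hp⟩
        exact hp A (hA Z hZ)
      · intro hA Z hZ
        obtain ⟨S, rfl⟩ := hF hZ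
        intro p hp
        exact hA p ⟨_, hZ, fun B hB => hB p hp⟩)
    (by
      rintro _ ⟨S, rfl⟩ _ ⟨T, rfl⟩
      refine ⟨{r | ∃ p ∈ S, ∃ q ∈ T, r = p * q}, ?_⟩
      ext A
      constructor
      · rintro (hA | hA) _ ⟨p, hp, q, hq, rfl⟩
        · simp [hA p hp]
        · simp [hA q hq]
      · intro hA
        by_contra hcon
        simp only [Set.mem_union, Set.mem_ofPred_eq, not_or, not_forall] at hcon
        obtain ⟨⟨p, hp, hp0⟩, ⟨q, hq, hq0⟩⟩ := hcon
        have := hA _ ⟨p, hp, q, hq, rfl⟩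
        rw [map_mul] at this
        exact (mul_ne_zero hp0 hq0) this)

/-- The nilpotent `n × n` matrices over `k`. -/
def NilpotentMatrix (k : Type*) [Field k] (n : ℕ) : Type _ :=
  {A : Matrix (Fin n) (Fin n) k // IsNilpotent A}

/-- The nilpotent matrices carry the topology induced by the Zariski topology. -/
instance NilpotentMatrix.instTopologicalSpace (k : Type*) [Field k] (n : ℕ) :
    TopologicalSpace (NilpotentMatrix k n) :=
  TopologicalSpace.induced Subtype.val (zariskiTopology k n)

theorem isNilpotent_conj {k : Type*} [Field k] {n : ℕ} (g : GL (Fin n) k)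
    {A : Matrix (Fin n) (Fin n) k} (hA : IsNilpotent A) :
    IsNilpotent ((g : Matrix (Fin n) (Fin n) k) * A *
      ((g⁻¹ : GL (Fin n) k) : Matrix (Fin n) (Fin n) k)) := by
  obtain ⟨m, hm⟩ := hA
  exact ⟨m, by rw [Units.conj_pow, hm, mul_zero, zero_mul]⟩

/-- The general linear group acts on the nilpotent matrices by conjugation,
`g • A = g A g⁻¹`. -/
instance NilpotentMatrix.instMulAction (k : Type*) [Field k] (n : ℕ) :
    MulAction (GL (Fin n) k) (NilpotentMatrix k n) where
  smul g A := ⟨_, isNilpotent_conj g A.2⟩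
  one_smul A := Subtype.ext (by
    change ((1 : GL (Fin n) k) : Matrix (Fin n) (Fin n) k) * A.1 *
      (((1 : GL (Fin n) k)⁻¹ : GL (Fin n) k) : Matrix (Fin n) (Fin n) k) = A.1
    simp)
  mul_smul g h A := Subtype.ext (by
    change ((g * h : GL (Fin n) k) : Matrix (Fin n) (Fin n) k) * A.1 *
        (((g * h)⁻¹ : GL (Fin n) k) : Matrix (Fin n) (Fin n) k) =
      (g : Matrix (Fin n) (Fin n) k) *
        ((h : Matrix (Fin n) (Fin n) k) * A.1 *
          ((h⁻¹ : GL (Fin n) k) : Matrix (Fin n) (Fin n) k)) *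
        ((g⁻¹ : GL (Fin n) k) : Matrix (Fin n) (Fin n) k)
    rw [mul_inv_rev, Units.val_mul, Units.val_mul]
    simp only [mul_assoc])

/-! ### Jordan types and the degeneration order -/

/-- The nilpotent Jordan block of size `d`, with ones on the first superdiagonal. -/
def nilpotentJordanBlock (k : Type*) [Field k] (d : ℕ) : Matrix (Fin d) (Fin d) k :=
  Matrix.of fun i j => if (i : ℕ) + 1 = j then 1 else 0

theorem nilpotentJordanBlock_pow_apply (k : Type*) [Field k] (d m : ℕ) (i j : Fin d) :
    (nilpotentJordanBlock k d ^ m) i j = if (i : ℕ) + m = j then 1 else 0 := by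
  induction m generalizing j with
  | zero => simp [Matrix.one_apply, Fin.ext_iff]
  | succ m ih =>
    rw [pow_succ, Matrix.mul_apply]
    simp only [ih]
    simp only [nilpotentJordanBlock, Matrix.of_apply, ite_mul, one_mul, zero_mul]
    by_cases h : (i : ℕ) + m < d
    · rw [Finset.sum_eq_single ⟨(i : ℕ) + m, h⟩]
      · simp [add_assoc]
      · intro b _ hb
        rw [if_neg]
        intro hib
        exact hb (Fin.ext hib.symm)
      · simp
    · rw [Finset.sum_eq_zero, if_neg]
      · have := j.2
        omega
      · intro b _
        rw [if_neg]
        have := b.2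
        omega

/-- The block diagonal matrix with the Jordan blocks of sizes `α_0, α_1, …` in this order
(blocks of size zero contribute nothing). -/
def jordanMatrix (k : Type*) [Field k] {n : ℕ} (α : n.Partition) :
    Matrix (Fin n) (Fin n) k :=
  Matrix.reindexAlgEquiv k k
    (finSigmaFinEquiv.trans (finCongr (sum_partitionPart α)))
    (Matrix.blockDiagonal' fun i : Fin n => nilpotentJordanBlock k (partitionPart α i))

theorem isNilpotent_jordanMatrix (k : Type*) [Field k] {n : ℕ} (α : n.Partition) :
    IsNilpotent (jordanMatrix k α) := by
  refine ⟨n, ?_⟩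
  rw [jordanMatrix, ← map_pow, ← Matrix.blockDiagonal'_pow]
  suffices h : (fun i : Fin n => nilpotentJordanBlock k (partitionPart α i)) ^ n = 0 by
    rw [h, Matrix.blockDiagonal'_zero, map_zero]
  funext i
  ext a b
  have h1 : partitionPart α i ≤ n := by
    conv_rhs => rw [← sum_partitionPart α]
    exact Finset.single_le_sum (f := fun i : Fin n => partitionPart α i)
      (fun _ _ => Nat.zero_le _) (Finset.mem_univ i)
  have h2 := b.2
  rw [Pi.pow_apply, nilpotentJordanBlock_pow_apply, if_neg (by omega)]
  rfl

/-- The orbit of the nilpotent matrices of Jordan type `α`. -/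
def nilpotentOrbit (k : Type*) [Field k] {n : ℕ} (α : n.Partition) :
    Set (NilpotentMatrix k n) :=
  MulAction.orbit (GL (Fin n) k) (⟨jordanMatrix k α, isNilpotent_jordanMatrix k α⟩ :
    NilpotentMatrix k n)

/-- The degeneration order: the orbit of type `β` lies in the closure of the orbit
of type `α`, taken in the space of nilpotent matrices. -/
def DegLE (k : Type*) [Field k] {n : ℕ} (α β : n.Partition) : Prop :=
  nilpotentOrbit k β ⊆ closure (nilpotentOrbit k α)

/-!
The two orders are compared through the dominance order, in which `α` lies above `β` when every
initial sum of `α` is at least that of `β`.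

A single box move `α ↦ β` is a degeneration along a line (`BoxMove.exists_conj_line`). Let it take
a box from the `i`-th part to the `j`-th, so that `N_β` has blocks of sizes `p - 1` and `q + 1`
where `N_α` has blocks of sizes `p` and `q`. Write `e_0, …` and `f_0, …` for the standard bases of
these two blocks of `N_β`, and let `T` send `f_0` to `e_s` with `s = p - q - 2` and kill all other
basis vectors. For `t ≠ 0` the matrix `N_β + t T` has the chain `f_q, …, f_0, t e_s, …, t e_0` of
length `p` and the complementary chain of the vectors `t e_{s + 1 + a} - f_a` of length `q`, so it
is conjugate to `N_α`. A polynomial that vanishes on the orbit of `N_α` then vanishes at all points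
of the line with `t ≠ 0`, hence at `t = 0` as well, because the field is infinite.

Conversely, the rank of `N_α ^ m` is at most `∑ l, (α_l - m)`, with truncated subtraction, and the
minors of `A ^ m` of larger size are polynomials in the entries of `A` that vanish on the orbit of
`N_α`. One of the minors of `N_β ^ m` of size `∑ l, (β_l - m)` is `1`. Hence a degeneration forces
`∑ l, (β_l - m) ≤ ∑ l, (α_l - m)` for all `m` (`DegLE.sum_sub_le`), and this says that `α`
dominates `β` (`dominates_of_sum_sub_le`). Finally a partition that strictly dominates `β` admits a
box move to a partition that still dominates `β` (`Dominates.exists_boxMove`), so that `α` is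
joined to `β` by a chain of box moves (`Dominates.boxLE`).
-/

open scoped Matrix

/-! ### Partitions as weakly decreasing sequences -/

theorem partitionPart_antitone {n : ℕ} (α : n.Partition) : Antitone (partitionPart α) := by
  intro i j hij
  have hs : (α.parts.sort (· ≥ ·)).Pairwise (· ≥ ·) := Multiset.pairwise_sort _ _
  unfold partitionPart
  rcases lt_or_ge j (α.parts.sort (· ≥ ·)).length with hj | hj
  · rw [List.getD_eq_getElem _ _ hj, List.getD_eq_getElem _ _ (hij.trans_lt hj)]
    rcases hij.eq_or_lt with rfl | hlt
    · exact le_rfl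
    · exact List.pairwise_iff_getElem.1 hs i j _ _ hlt
  · rw [List.getD_eq_default _ _ hj]
    exact Nat.zero_le _

theorem partitionPart_eq_zero {n : ℕ} (α : n.Partition) {i : ℕ} (hi : n ≤ i) :
    partitionPart α i = 0 := by
  apply List.getD_eq_default
  refine (list_length_le_sum _ fun x hx => α.parts_pos (by simpa using hx)).trans ?_
  rwa [← Multiset.sum_coe, Multiset.sort_eq, α.parts_sum]

theorem sum_range_partitionPart {n : ℕ} (α : n.Partition) {r : ℕ} (hr : n ≤ r) :
    ∑ l ∈ Finset.range r, partitionPart α l = n := by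
  rw [← Finset.sum_subset (Finset.range_subset_range.2 hr)
    (fun l _ hl => partitionPart_eq_zero α (by simpa using hl)),
    ← Fin.sum_univ_eq_sum_range, sum_partitionPart]

theorem list_eq_of_getD_eq {L M : List ℕ} (hL : ∀ x ∈ L, 0 < x) (hM : ∀ x ∈ M, 0 < x)
    (h : ∀ i, L.getD i 0 = M.getD i 0) : L = M := by
  induction L generalizing M with
  | nil =>
    cases M with
    | nil => rfl
    | cons b M =>
      have h0 := h 0
      have := hM b List.mem_cons_self
      simp at h0
      omega
  | cons a L ih =>
    cases M with
    | nil =>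
      have h0 := h 0
      have := hL a List.mem_cons_self
      simp at h0
      omega
    | cons b M =>
      have h0 : a = b := by simpa using h 0
      rw [h0, ih (fun x hx => hL x (List.mem_cons_of_mem _ hx))
        (fun x hx => hM x (List.mem_cons_of_mem _ hx)) fun i => by simpa using h (i + 1)]

theorem partitionPart_injective {n : ℕ} :
    Function.Injective (partitionPart : n.Partition → ℕ → ℕ) := by
  intro α β h
  have := list_eq_of_getD_eq (L := α.parts.sort (· ≥ ·)) (M := β.parts.sort (· ≥ ·))
    (fun x hx => α.parts_pos (by simpa using hx)) (fun x hx => β.parts_pos (by simpa using hx))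
    (fun i => congrFun h i)
  ext1
  rw [← Multiset.sort_eq α.parts (· ≥ ·), this, Multiset.sort_eq]

theorem exists_partitionPart_eq {n : ℕ} {f : ℕ → ℕ} (hf : Antitone f) (h0 : f n = 0)
    (hsum : ∑ l ∈ Finset.range n, f l = n) : ∃ γ : n.Partition, partitionPart γ = f := by
  have hex : ∃ d, f d = 0 := ⟨n, h0⟩
  -- `d` is the number of positive terms of the sequence.
  obtain ⟨d, hd0, hdlt⟩ : ∃ d, f d = 0 ∧ ∀ i < d, 0 < f i :=
    ⟨Nat.find hex, Nat.find_spec hex, fun i hi => Nat.pos_of_ne_zero (Nat.find_min hex hi)⟩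
  have hdn : d ≤ n := by
    by_contra h
    exact (hdlt n (not_le.1 h)).ne' h0
  have hge : ∀ i, d ≤ i → f i = 0 := fun i hi => Nat.le_zero.1 (hd0 ▸ hf hi)
  refine ⟨⟨((List.range d).map f : List ℕ), ?_, ?_⟩, ?_⟩
  · intro i hi
    obtain ⟨a, ha, rfl⟩ := List.mem_map.1 (Multiset.mem_coe.1 hi)
    exact hdlt a (List.mem_range.1 ha)
  · rw [Multiset.sum_coe, ← hsum, ← Finset.sum_subset (Finset.range_subset_range.2 hdn)
      (fun l _ hl => hge l (by simpa using hl))]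
    rfl
  · have hs : ((List.range d).map f).Pairwise (· ≥ ·) := by
      rw [List.pairwise_map]
      exact List.pairwise_lt_range.imp fun h => hf h.le
    funext i
    unfold partitionPart
    simp only [Multiset.coe_sort]
    rw [List.mergeSort_eq_self _ (by simpa using hs)]
    rcases lt_or_ge i d with hi | hi
    · rw [List.getD_eq_getElem _ _ (by simpa using hi)]
      simp
    · rw [List.getD_eq_default _ _ (by simpa using hi), hge i hi]

/-! ### The box order and the dominance order -/

/-- The dominance order on partitions of `n`: every initial sum of `β` is bounded by the
corresponding initial sum of `α`. -/
def Dominates {n : ℕ} (α β : n.Partition) : Prop :=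
  ∀ r, ∑ l ∈ Finset.range r, partitionPart β l ≤ ∑ l ∈ Finset.range r, partitionPart α l

/-- The numbers `∑ l, (α_l - m)` are the sums of the tails of the conjugate partition, so
comparing them for all `m` amounts to comparing the partitions for the dominance order. -/
theorem dominates_of_sum_sub_le {n : ℕ} {α β : n.Partition}
    (h : ∀ m, ∑ l : Fin n, (partitionPart β l - m) ≤ ∑ l : Fin n, (partitionPart α l - m)) :
    Dominates α β := by
  intro r
  rcases le_total n r with hr | hr
  · rw [sum_range_partitionPart α hr, sum_range_partitionPart β hr]
  -- With `m = α_r` only the parts of `α` before the `r`-th contribute.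
  set m := partitionPart α r with hm
  have hα : ∑ l : Fin n, (partitionPart α l - m) =
      ∑ l ∈ Finset.range r, (partitionPart α l - m) := by
    rw [Fin.sum_univ_eq_sum_range (fun l => partitionPart α l - m)]
    refine (Finset.sum_subset (Finset.range_subset_range.2 hr) fun l _ hl => ?_).symm
    have := partitionPart_antitone α (by simpa using hl : r ≤ l)
    omega
  have hβ : ∑ l ∈ Finset.range r, (partitionPart β l - m) ≤
      ∑ l : Fin n, (partitionPart β l - m) := by
    rw [Fin.sum_univ_eq_sum_range (fun l => partitionPart β l - m)]
    exact Finset.sum_le_sum_of_subset (Finset.range_subset_range.2 hr)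
  calc ∑ l ∈ Finset.range r, partitionPart β l
      ≤ ∑ l ∈ Finset.range r, ((partitionPart β l - m) + m) :=
        Finset.sum_le_sum fun l _ => by omega
    _ ≤ ∑ l ∈ Finset.range r, ((partitionPart α l - m) + m) := by
        rw [Finset.sum_add_distrib, Finset.sum_add_distrib]
        have := h m
        omega
    _ = ∑ l ∈ Finset.range r, partitionPart α l := by
        refine Finset.sum_congr rfl fun l hl => ?_
        have := partitionPart_antitone α (Finset.mem_range.1 hl).le
        omega

/-- Moving a unit from position `i` to position `j > i` lowers exactly the initial sums that
contain the `i`-th term but not the `j`-th. -/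
theorem sum_range_move {f g : ℕ → ℕ} {i j : ℕ} (hij : i < j) (hi : f i = g i + 1)
    (hj : f j + 1 = g j) (hl : ∀ l, l ≠ i → l ≠ j → f l = g l) (r : ℕ) :
    ∑ l ∈ Finset.range r, f l =
      ∑ l ∈ Finset.range r, g l + if i < r ∧ r ≤ j then 1 else 0 := by
  induction r with
  | zero => simp
  | succ r ih =>
    rw [Finset.sum_range_succ, Finset.sum_range_succ, ih]
    rcases eq_or_ne r i with rfl | h1
    · rw [if_neg (by omega), if_pos (by omega)]
      omega
    rcases eq_or_ne r j with rfl | h2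
    · rw [if_pos (by omega), if_neg (by omega)]
      omega
    rw [hl r h1 h2]
    have : (i < r ∧ r ≤ j) ↔ (i < r + 1 ∧ r + 1 ≤ j) := by omega
    simp only [this]
    omega

/-- Below a strict dominance there is always a box move that stays above: with `c` the first
part of `α` that exceeds the corresponding part of `β`, a box is moved from the last part equal
to `c` to the first part that is at most `c - 2`. -/
theorem Dominates.exists_boxMove {n : ℕ} {α β : n.Partition} (h : Dominates α β) (hne : α ≠ β) :
    ∃ γ, BoxMove α γ ∧ Dominates γ β := by
  have hex : ∃ i, partitionPart α i ≠ partitionPart β i := by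
    by_contra! hcon
    exact hne (partitionPart_injective (funext hcon))
  obtain ⟨i₀, hi₀, hmin⟩ : ∃ i₀, partitionPart α i₀ ≠ partitionPart β i₀ ∧
      ∀ l < i₀, partitionPart α l = partitionPart β l :=
    ⟨Nat.find hex, Nat.find_spec hex, fun l hl => not_not.1 (Nat.find_min hex hl)⟩
  have hα := partitionPart_antitone α
  have hβ := partitionPart_antitone β
  have hsum₀ : ∑ l ∈ Finset.range i₀, partitionPart α l =
      ∑ l ∈ Finset.range i₀, partitionPart β l :=
    Finset.sum_congr rfl fun l hl => hmin l (Finset.mem_range.1 hl)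
  set c := partitionPart α i₀ with hc
  have hcβ : partitionPart β i₀ < c := by
    have := h (i₀ + 1)
    rw [Finset.sum_range_succ, Finset.sum_range_succ, hsum₀] at this
    omega
  -- As long as the parts of `α` are at least `c - 1`, the initial sums stay strictly larger.
  have hstrict : ∀ r, i₀ < r → (∀ l, i₀ < l → l < r → c ≤ partitionPart α l + 1) →
      ∑ l ∈ Finset.range r, partitionPart β l < ∑ l ∈ Finset.range r, partitionPart α l := by
    intro r hr
    induction r, hr using Nat.le_induction with
    | base =>
      intro _
      rw [Finset.sum_range_succ, Finset.sum_range_succ, hsum₀]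
      omega
    | succ r hr ih =>
      intro hl
      have h1 := ih fun l h1 h2 => hl l h1 (by omega)
      have h2 := hl r hr (by omega)
      have h3 := hβ (show i₀ ≤ r by omega)
      rw [Finset.sum_range_succ, Finset.sum_range_succ]
      omega
  have hc2 : 2 ≤ c := by
    by_contra hlt
    have := hstrict (max n (i₀ + 1)) (by omega) fun l _ _ => by omega
    rw [sum_range_partitionPart α (by omega), sum_range_partitionPart β (by omega)] at this
    omega
  have hex1 : ∃ x, partitionPart α x < c := ⟨n, by rw [partitionPart_eq_zero α le_rfl]; omega⟩
  have hex2 : ∃ x, partitionPart α x + 2 ≤ c :=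
    ⟨n, by rw [partitionPart_eq_zero α le_rfl]; omega⟩
  obtain ⟨x, hx, hxmin⟩ : ∃ x, partitionPart α x < c ∧ ∀ l < x, c ≤ partitionPart α l :=
    ⟨Nat.find hex1, Nat.find_spec hex1, fun l hl => not_lt.1 (Nat.find_min hex1 hl)⟩
  obtain ⟨j, hj, hjmin⟩ : ∃ j, partitionPart α j + 2 ≤ c ∧
      ∀ l < j, c ≤ partitionPart α l + 1 :=
    ⟨Nat.find hex2, Nat.find_spec hex2, fun l hl => by
      have := Nat.find_min hex2 hl
      omega⟩
  have hxi : i₀ < x := by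
    by_contra hle
    have := hα (not_lt.1 hle)
    omega
  obtain ⟨i, rfl⟩ : ∃ i, x = i + 1 := ⟨x - 1, by omega⟩
  have hij : i < j := by
    by_contra hle
    have := hxmin j (by omega)
    omega
  have hi : partitionPart α i = c := le_antisymm (hα (by omega)) (hxmin i (by omega))
  have hjn : j < n := by
    by_contra hle
    have := hstrict j (by omega) fun l _ hl => hjmin l hl
    rw [sum_range_partitionPart α (by omega), sum_range_partitionPart β (by omega)] at this
    omega
  set f : ℕ → ℕ := fun l =>
    if l = i then c - 1 else if l = j then partitionPart α j + 1 else partitionPart α l with hf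
  have hfi : partitionPart α i = f i + 1 := by simp only [hf, if_true]; omega
  have hfj : partitionPart α j + 1 = f j := by simp [hf, hij.ne']
  have hfl : ∀ l, l ≠ i → l ≠ j → partitionPart α l = f l := by
    intro l h1 h2
    simp [hf, h1, h2]
  have hmove := sum_range_move hij hfi hfj hfl
  have hanti : Antitone f := by
    refine antitone_nat_of_succ_le fun l => ?_
    have h1 : partitionPart α (l + 1) ≤ partitionPart α l := hα (Nat.le_succ l)
    rcases lt_trichotomy l i with hli | rfl | hli
    · rw [← hfl l (by omega) (by omega)]
      rcases eq_or_ne (l + 1) i with rfl | h2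
      · omega
      · rw [← hfl (l + 1) h2 (by omega)]
        exact h1
    · rcases eq_or_ne (l + 1) j with rfl | h2
      · omega
      · rw [← hfl (l + 1) (by omega) h2]
        omega
    · rcases eq_or_ne (l + 1) j with rfl | h2
      · have := hjmin l (by omega)
        rw [← hfl l (by omega) (by omega)]
        omega
      · rw [← hfl (l + 1) (by omega) h2]
        rcases eq_or_ne l j with rfl | h3
        · omega
        · rw [← hfl l (by omega) h3]
          exact h1
  have hfn : f n = 0 := by
    rw [← hfl n (by omega) (by omega), partitionPart_eq_zero α le_rfl]
  have hfsum : ∑ l ∈ Finset.range n, f l = n := by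
    have := hmove n
    rw [sum_range_partitionPart α le_rfl, if_neg (by omega)] at this
    omega
  obtain ⟨γ, hγ⟩ := exists_partitionPart_eq hanti hfn hfsum
  refine ⟨γ, ⟨i, j, hij, ?_⟩, fun r => ?_⟩
  · rw [hγ]
    exact ⟨hfi, hfj, hfl⟩
  · rw [hγ]
    have h1 := hmove r
    by_cases hr : i < r ∧ r ≤ j
    · have := hstrict r (by omega) fun l _ hl => hjmin l (by omega)
      rw [if_pos hr] at h1
      omega
    · have := h r
      rw [if_neg hr] at h1
      omega

theorem Dominates.boxLE {n : ℕ} {α β : n.Partition} (h : Dominates α β) : BoxLE α β := by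
  -- The sum of all initial sums of `α` decreases along the box moves.
  induction hN : ∑ r ∈ Finset.range (n + 1), ∑ l ∈ Finset.range r, partitionPart α l
    using Nat.strong_induction_on generalizing α with
  | _ N ih =>
    by_cases hne : α = β
    · rw [hne]
      exact Relation.ReflTransGen.refl
    obtain ⟨γ, hαγ, hγβ⟩ := h.exists_boxMove hne
    refine Relation.ReflTransGen.head hαγ (ih _ ?_ hγβ rfl)
    obtain ⟨i, j, hij, hi, hj, hl⟩ := hαγ
    have hmove := sum_range_move hij hi hj hl
    have hin : i < n := by
      by_contra hle
      have := partitionPart_eq_zero α (not_lt.1 hle)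
      omega
    rw [← hN]
    refine Finset.sum_lt_sum (fun r _ => by rw [hmove r]; omega)
      ⟨i + 1, Finset.mem_range.2 (by omega), ?_⟩
    rw [hmove, if_pos (by omega)]
    omega

/-! ### The Zariski closure of an orbit -/

theorem mem_closure_nilpotentMatrix_iff {k : Type*} [Field k] {n : ℕ}
    {S : Set (NilpotentMatrix k n)} {A : NilpotentMatrix k n} :
    A ∈ closure S ↔ ∀ p : MvPolynomial (Fin n × Fin n) k,
      (∀ B ∈ S, MvPolynomial.eval (fun x => B.1 x.1 x.2) p = 0) →
        MvPolynomial.eval (fun x => A.1 x.1 x.2) p = 0 := by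
  let _ := zariskiTopology k n
  have hclosed : ∀ Z : Set (Matrix (Fin n) (Fin n) k), IsClosed Z ↔
      ∃ S : Set (MvPolynomial (Fin n × Fin n) k),
        Z = {A | ∀ p ∈ S, MvPolynomial.eval (fun x => A x.1 x.2) p = 0} := by
    intro Z
    rw [← isOpen_compl_iff]
    change Zᶜᶜ ∈ _ ↔ _
    rw [compl_compl]
    rfl
  have hcl : A ∈ closure S ↔ A.1 ∈ closure (Subtype.val '' S) := closure_induced
  rw [hcl]
  constructor
  · intro hA p hp
    have hZ : IsClosed {B : Matrix (Fin n) (Fin n) k |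
        MvPolynomial.eval (fun x => B x.1 x.2) p = 0} :=
      (hclosed _).2 ⟨{p}, by simp⟩
    refine closure_minimal ?_ hZ hA
    rintro _ ⟨B, hB, rfl⟩
    exact hp B hB
  · intro h
    obtain ⟨T, hT⟩ := (hclosed (closure (Subtype.val '' S))).1 isClosed_closure
    rw [hT]
    intro p hp
    refine h p fun B hB => ?_
    have : B.1 ∈ closure (Subtype.val '' S) := subset_closure ⟨B, hB, rfl⟩
    rw [hT] at this
    exact this p hp

theorem mem_nilpotentOrbit_iff {k : Type*} [Field k] {n : ℕ} {α : n.Partition}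
    {A : NilpotentMatrix k n} :
    A ∈ nilpotentOrbit k α ↔ ∃ g : GL (Fin n) k,
      g.1 * jordanMatrix k α * (g⁻¹ : GL (Fin n) k).1 = A.1 :=
  ⟨fun ⟨g, hg⟩ => ⟨g, congrArg Subtype.val hg⟩, fun ⟨g, hg⟩ => ⟨g, Subtype.ext hg⟩⟩

/-- If a line through `A` meets the set `S` in all points other than `A`, then `A` lies in the
closure of `S`: a polynomial vanishing on the rest of the line vanishes at `A` too, as the field
is infinite. -/
theorem mem_closure_of_line {k : Type*} [Field k] [Infinite k] {n : ℕ}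
    {S : Set (NilpotentMatrix k n)} {A : NilpotentMatrix k n} (T : Matrix (Fin n) (Fin n) k)
    (h : ∀ t : k, t ≠ 0 → ∃ B ∈ S, B.1 = A.1 + t • T) : A ∈ closure S := by
  rw [mem_closure_nilpotentMatrix_iff]
  intro p hp
  set q : Polynomial k := MvPolynomial.aeval
    (fun x => Polynomial.C (A.1 x.1 x.2) + Polynomial.X * Polynomial.C (T x.1 x.2)) p with hq
  have heval : ∀ t : k, q.eval t =
      MvPolynomial.eval (fun x => (A.1 + t • T) x.1 x.2) p := by
    intro t
    rw [hq, ← Polynomial.coe_evalRingHom, MvPolynomial.aeval_def,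
      MvPolynomial.hom_eval₂, MvPolynomial.eval₂_eq', MvPolynomial.eval_eq']
    simp [mul_comm t]
  have hXq : Polynomial.X * q = 0 := by
    refine Polynomial.funext fun t => ?_
    rcases eq_or_ne t 0 with rfl | ht
    · simp
    · obtain ⟨B, hB, hBt⟩ := h t ht
      rw [Polynomial.eval_mul, heval t, ← hBt, hp B hB]
      simp
  have hq0 : q = 0 := (mul_eq_zero.1 hXq).resolve_left Polynomial.X_ne_zero
  have := heval 0
  rw [hq0] at this
  simpa using this.symm

/-! ### Jordan matrices in coordinates -/

/-- The position in `Fin n` of the `a`-th index of the `l`-th Jordan block. -/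
def jordanIndex {n : ℕ} (α : n.Partition) :
    (Σ l : Fin n, Fin (partitionPart α l)) ≃ Fin n :=
  finSigmaFinEquiv.trans (finCongr (sum_partitionPart α))

theorem jordanMatrix_pow_apply (k : Type*) [Field k] {n : ℕ} (α : n.Partition) (m : ℕ)
    (x y : Σ l : Fin n, Fin (partitionPart α l)) :
    (jordanMatrix k α ^ m) (jordanIndex α x) (jordanIndex α y) =
      if x.1 = y.1 ∧ (x.2 : ℕ) + m = y.2 then 1 else 0 := by
  obtain ⟨l, a⟩ := x
  obtain ⟨l', b⟩ := y
  rw [jordanMatrix, ← map_pow, ← Matrix.blockDiagonal'_pow]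
  change Matrix.reindex (jordanIndex α) (jordanIndex α) _ _ _ = _
  rw [Matrix.reindex_apply, Matrix.submatrix_apply, Equiv.symm_apply_apply,
    Equiv.symm_apply_apply]
  rcases eq_or_ne l l' with rfl | h
  · rw [Matrix.blockDiagonal'_apply_eq, Pi.pow_apply, nilpotentJordanBlock_pow_apply]
    simp
  · rw [Matrix.blockDiagonal'_apply_ne _ _ _ h]
    simp [h]

/-- The `a`-th standard basis vector of the `l`-th Jordan block; it is zero by convention
when `a` is not smaller than the size of the block. -/
def jordanVec (k : Type*) [Field k] {n : ℕ} (α : n.Partition) (l : Fin n) (a : ℕ) : Fin n → k :=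
  if h : a < partitionPart α l then Pi.single (jordanIndex α ⟨l, a, h⟩) 1 else 0

theorem jordanVec_apply (k : Type*) [Field k] {n : ℕ} (α : n.Partition) (l : Fin n) (a : ℕ)
    (x : Σ l : Fin n, Fin (partitionPart α l)) :
    jordanVec k α l a (jordanIndex α x) = if x.1 = l ∧ (x.2 : ℕ) = a then 1 else 0 := by
  obtain ⟨l', b⟩ := x
  unfold jordanVec
  split_ifs with h h' h'
  · obtain ⟨rfl, rfl⟩ := h'
    simp
  · rw [Pi.single_apply, if_neg]
    intro heq
    have := (jordanIndex α).injective heq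
    obtain ⟨rfl, hb⟩ := Sigma.mk.inj_iff.1 this
    exact h' ⟨rfl, congrArg Fin.val (eq_of_heq hb)⟩
  · obtain ⟨rfl, rfl⟩ := h'
    exact absurd b.2 h
  · rfl

theorem jordanMatrix_mulVec_jordanVec_zero (k : Type*) [Field k] {n : ℕ} (α : n.Partition)
    (l : Fin n) : jordanMatrix k α *ᵥ jordanVec k α l 0 = 0 := by
  by_cases h : 0 < partitionPart α l
  · funext i
    obtain ⟨x, rfl⟩ := (jordanIndex α).surjective i
    have := jordanMatrix_pow_apply k α 1 x ⟨l, 0, h⟩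
    rw [pow_one] at this
    rw [jordanVec, dif_pos h, Matrix.mulVec_single_one, Matrix.col_apply, this]
    simp
  · rw [jordanVec, dif_neg h, Matrix.mulVec_zero]

theorem jordanMatrix_mulVec_jordanVec_succ (k : Type*) [Field k] {n : ℕ} (α : n.Partition)
    (l : Fin n) (a : ℕ) (h : a + 1 < partitionPart α l) :
    jordanMatrix k α *ᵥ jordanVec k α l (a + 1) = jordanVec k α l a := by
  funext i
  obtain ⟨x, rfl⟩ := (jordanIndex α).surjective i
  have := jordanMatrix_pow_apply k α 1 x ⟨l, a + 1, h⟩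
  rw [pow_one] at this
  rw [jordanVec_apply, jordanVec, dif_pos h, Matrix.mulVec_single_one, Matrix.col_apply, this]
  simp

theorem jordanVec_dotProduct (k : Type*) [Field k] {n : ℕ} (α : n.Partition) (l l' : Fin n)
    (a b : ℕ) (h : a < partitionPart α l) :
    jordanVec k α l a ⬝ᵥ jordanVec k α l' b = if l = l' ∧ a = b then 1 else 0 := by
  rw [jordanVec, dif_pos h, single_one_dotProduct, jordanVec_apply]

theorem eq_top_of_jordanVec_mem {k : Type*} [Field k] {n : ℕ} {α : n.Partition}
    {V : Submodule k (Fin n → k)}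
    (h : ∀ (l : Fin n) (a : ℕ), a < partitionPart α l → jordanVec k α l a ∈ V) : V = ⊤ := by
  rw [eq_top_iff, ← (Pi.basisFun k (Fin n)).span_eq, Submodule.span_le]
  rintro _ ⟨i, rfl⟩
  obtain ⟨⟨l, a⟩, rfl⟩ := (jordanIndex α).surjective i
  have := h l a a.2
  rw [jordanVec, dif_pos a.2] at this
  simpa using this

/-- A matrix whose space is spanned by chains `b l 0, …, b l (α_l - 1)`, along which the matrix
lowers the index, is conjugate to the Jordan matrix of type `α`. -/
theorem exists_conj_jordanMatrix_of_chains {k : Type*} [Field k] {n : ℕ} {α : n.Partition}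
    {A : Matrix (Fin n) (Fin n) k} (b : Fin n → ℕ → Fin n → k)
    (h0 : ∀ l : Fin n, 0 < partitionPart α l → A *ᵥ b l 0 = 0)
    (hsucc : ∀ (l : Fin n) (a : ℕ), a + 1 < partitionPart α l → A *ᵥ b l (a + 1) = b l a)
    (hspan : Submodule.span k
      {v | ∃ (l : Fin n) (a : ℕ), a < partitionPart α l ∧ b l a = v} = ⊤) :
    ∃ g : GL (Fin n) k, g.1 * jordanMatrix k α * (g⁻¹ : GL (Fin n) k).1 = A := by
  set P : Matrix (Fin n) (Fin n) k := Matrix.of fun i j =>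
    b ((jordanIndex α).symm j).1 ((jordanIndex α).symm j).2 i with hP
  have hcol : ∀ x, P.col (jordanIndex α x) = b x.1 x.2 := by
    intro x
    funext i
    rw [Matrix.col_apply, hP, Matrix.of_apply, Equiv.symm_apply_apply]
  have hunit : IsUnit P := by
    rw [← Matrix.mulVec_surjective_iff_isUnit]
    change Function.Surjective P.mulVecLin
    rw [← LinearMap.range_eq_top, Matrix.range_mulVecLin, eq_top_iff, ← hspan]
    refine Submodule.span_mono ?_
    rintro _ ⟨l, a, ha, rfl⟩
    exact ⟨jordanIndex α ⟨l, a, ha⟩, hcol _⟩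
  have hAP : A * P = P * jordanMatrix k α := by
    ext i j
    obtain ⟨⟨l, ⟨a, ha⟩⟩, rfl⟩ := (jordanIndex α).surjective j
    have hvec : jordanVec k α l a = Pi.single (jordanIndex α ⟨l, a, ha⟩) 1 := by
      rw [jordanVec, dif_pos ha]
    suffices hs : (A * P) *ᵥ jordanVec k α l a = (P * jordanMatrix k α) *ᵥ jordanVec k α l a by
      rw [hvec, Matrix.mulVec_single_one, Matrix.mulVec_single_one] at hs
      exact congrFun hs i
    have hPvec : ∀ a, a < partitionPart α l → P *ᵥ jordanVec k α l a = b l a := by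
      intro a ha
      rw [jordanVec, dif_pos ha, Matrix.mulVec_single_one, hcol]
    rw [← Matrix.mulVec_mulVec, ← Matrix.mulVec_mulVec, hPvec a ha]
    cases a with
    | zero =>
      rw [h0 l ha, jordanMatrix_mulVec_jordanVec_zero, Matrix.mulVec_zero]
    | succ a =>
      rw [hsucc l a ha, jordanMatrix_mulVec_jordanVec_succ k α l a ha, hPvec a (by omega)]
  obtain ⟨g, hg⟩ := hunit
  refine ⟨g, ?_⟩
  rw [hg, ← hAP, ← hg, mul_assoc, ← Units.val_mul, mul_inv_cancel, Units.val_one, mul_one]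

/-! ### Box moves are degenerations -/

/-- The matrix `T` is a matrix unit: it sends the vector of the `j`-th block that `N_β` kills to a
suitable vector of the `i`-th block. For `t ≠ 0` this lengthens the chain of the `i`-th block by
one, at the expense of the `j`-th block, and so turns the Jordan type `β` into `α`. -/
theorem BoxMove.exists_conj_line {n : ℕ} {α β : n.Partition} (h : BoxMove α β)
    (k : Type*) [Field k] :
    ∃ T : Matrix (Fin n) (Fin n) k, ∀ t : k, t ≠ 0 →
      ∃ g : GL (Fin n) k, g.1 * jordanMatrix k α * (g⁻¹ : GL (Fin n) k).1 =
        jordanMatrix k β + t • T := by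
  obtain ⟨i', j', hij, hi, hj, hl⟩ := h
  have hjn : j' < n := by
    by_contra hle
    have := partitionPart_eq_zero β (not_lt.1 hle)
    omega
  obtain ⟨i, rfl⟩ : ∃ i : Fin n, (i : ℕ) = i' := ⟨⟨i', hij.trans hjn⟩, rfl⟩
  obtain ⟨j, rfl⟩ : ∃ j : Fin n, (j : ℕ) = j' := ⟨⟨j', hjn⟩, rfl⟩
  have hne : i ≠ j := fun h => by simp [h] at hij
  have hβ : partitionPart β j ≤ partitionPart β i := partitionPart_antitone β hij.le
  -- The chain of length `β_j = α_j + 1` is continued by `s + 1` vectors to one of length `α_i`.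
  obtain ⟨s, hs⟩ : ∃ s, partitionPart β i = partitionPart α j + (s + 1) :=
    ⟨partitionPart β i - partitionPart α j - 1, by omega⟩
  set e := jordanVec k β
  set N := jordanMatrix k β
  have hN0 : ∀ l, N *ᵥ e l 0 = 0 := jordanMatrix_mulVec_jordanVec_zero k β
  have hNs : ∀ (l : Fin n) (a : ℕ), a + 1 < partitionPart β l → N *ᵥ e l (a + 1) = e l a :=
    jordanMatrix_mulVec_jordanVec_succ k β
  refine ⟨Matrix.vecMulVec (e i s) (e j 0), fun t ht => ?_⟩
  have hA : ∀ l a, (N + t • Matrix.vecMulVec (e i s) (e j 0)) *ᵥ e l a =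
      N *ᵥ e l a + if j = l ∧ 0 = a then t • e i s else 0 := by
    intro l a
    rw [Matrix.add_mulVec, Matrix.smul_mulVec, Matrix.vecMulVec_mulVec,
      jordanVec_dotProduct k β j l 0 a (by omega)]
    split_ifs <;> simp
  set A := N + t • Matrix.vecMulVec (e i s) (e j 0)
  -- The `i`-th chain descends through the whole `j`-th block of `N_β` and then, by the added
  -- term, through the first `s + 1` vectors of the `i`-th block. In the `j`-th chain the two
  -- terms of `b j 0` have the same image `t • e i s`, so their difference is killed.
  set b : Fin n → ℕ → Fin n → k := fun l a =>
    if l = i then (if a < s + 1 then t • e i a else e j (a - (s + 1)))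
    else if l = j then t • e i (s + 1 + a) - e j a else e l a with hb
  have hbi : ∀ a, a < s + 1 → b i a = t • e i a := fun a ha => by
    simp only [hb, if_true, if_pos ha]
  have hbi' : ∀ a, b i (s + 1 + a) = e j a := fun a => by
    simp only [hb, if_true, if_neg (show ¬ s + 1 + a < s + 1 by omega), Nat.add_sub_cancel_left]
  have hbj : ∀ a, b j a = t • e i (s + 1 + a) - e j a := fun a => by simp [hb, hne.symm]
  have hbl : ∀ l, l ≠ i → l ≠ j → b l = e l := fun l h1 h2 => by simp [hb, h1, h2]
  have hlF : ∀ l : Fin n, l ≠ i → l ≠ j → partitionPart α l = partitionPart β l :=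
    fun l h1 h2 => hl l (Fin.val_ne_of_ne h1) (Fin.val_ne_of_ne h2)
  refine exists_conj_jordanMatrix_of_chains b (fun l hpos => ?_) (fun l a ha => ?_) ?_
  · rcases eq_or_ne l i with rfl | h1
    · rw [hbi 0 (by omega), Matrix.mulVec_smul, hA, hN0, if_neg (by simp [hne.symm])]
      simp
    rcases eq_or_ne l j with rfl | h2
    · rw [hbj, Matrix.mulVec_sub, Matrix.mulVec_smul, hA, hA, hN0, if_neg (by simp [hne.symm]),
        if_pos ⟨rfl, rfl⟩, add_zero, hNs i s (by omega)]
      simp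
    · rw [hbl l h1 h2, hA, hN0, if_neg (by simp [h2.symm]), add_zero]
  · rcases eq_or_ne l i with rfl | h1
    · rcases lt_trichotomy a s with has | rfl | has
      · rw [hbi _ (by omega), hbi _ (by omega), Matrix.mulVec_smul, hA,
          if_neg (by simp), add_zero, hNs l a (by omega)]
      · rw [hbi a (by omega), ← add_zero (a + 1), hbi', hA, hN0, if_pos ⟨rfl, rfl⟩, zero_add]
      · obtain ⟨c, rfl⟩ : ∃ c, a = s + 1 + c := ⟨a - (s + 1), by omega⟩
        rw [hbi', add_assoc (s + 1), hbi', hA, if_neg (by simp), add_zero, hNs j c (by omega)]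
    rcases eq_or_ne l j with rfl | h2
    · rw [hbj, hbj, Matrix.mulVec_sub, Matrix.mulVec_smul, hA, hA, if_neg (by simp),
        if_neg (by simp), add_zero, add_zero, ← add_assoc, hNs i _ (by omega),
        hNs l a (by omega)]
    · rw [hbl l h1 h2, hA, if_neg (by simp), add_zero, hNs l a (by rw [← hlF l h1 h2]; exact ha)]
  · set V := Submodule.span k {v | ∃ (l : Fin n) (a : ℕ), a < partitionPart α l ∧ b l a = v}
    have hV : ∀ (l : Fin n) (a : ℕ), a < partitionPart α l → b l a ∈ V :=
      fun l a ha => Submodule.subset_span ⟨l, a, ha, rfl⟩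
    have hVj : ∀ a, a < partitionPart β j → e j a ∈ V := by
      intro a ha
      rw [← hbi']
      exact hV i _ (by omega)
    refine eq_top_of_jordanVec_mem (α := β) fun l a ha => ?_
    rcases eq_or_ne l i with rfl | h1
    · suffices ht' : t • e l a ∈ V by
        simpa [smul_smul, inv_mul_cancel₀ ht] using V.smul_mem t⁻¹ ht'
      rcases lt_or_ge a (s + 1) with has | has
      · rw [← hbi a has]
        exact hV l a (by omega)
      · obtain ⟨c, rfl⟩ : ∃ c, a = s + 1 + c := ⟨a - (s + 1), by omega⟩
        have := V.add_mem (hV j c (by omega)) (hVj c (by omega))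
        rwa [hbj, sub_add_cancel] at this
    rcases eq_or_ne l j with rfl | h2
    · exact hVj a ha
    · have := hV l a (by rw [hlF l h1 h2]; exact ha)
      rwa [hbl l h1 h2] at this

theorem BoxMove.degLE {n : ℕ} {α β : n.Partition} (h : BoxMove α β) (k : Type*) [Field k]
    [Infinite k] : DegLE k α β := by
  intro C hC
  obtain ⟨T, hT⟩ := h.exists_conj_line k
  obtain ⟨x, hx⟩ := mem_nilpotentOrbit_iff.1 hC
  refine mem_closure_of_line (x.1 * T * (x⁻¹ : GL (Fin n) k).1) fun t ht => ?_
  obtain ⟨g, hg⟩ := hT t ht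
  refine ⟨⟨_, isNilpotent_conj (x * g) (isNilpotent_jordanMatrix k α)⟩,
    mem_nilpotentOrbit_iff.2 ⟨x * g, rfl⟩, ?_⟩
  change (x * g).1 * jordanMatrix k α * ((x * g)⁻¹ : GL (Fin n) k).1 = _
  rw [← hx, mul_inv_rev, Units.val_mul, Units.val_mul]
  calc x.1 * g.1 * jordanMatrix k α * ((g⁻¹ : GL (Fin n) k).1 * (x⁻¹ : GL (Fin n) k).1)
      = x.1 * (g.1 * jordanMatrix k α * (g⁻¹ : GL (Fin n) k).1) * (x⁻¹ : GL (Fin n) k).1 := by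
        simp only [mul_assoc]
    _ = _ := by
        rw [hg, mul_add, add_mul, Matrix.mul_smul, Matrix.smul_mul]

theorem BoxLE.degLE {n : ℕ} {α β : n.Partition} (h : BoxLE α β) (k : Type*) [Field k]
    [Infinite k] : DegLE k α β := by
  induction h with
  | refl => exact subset_closure
  | tail _ hmove ih => exact (hmove.degLE k).trans (closure_minimal ih isClosed_closure)

/-! ### Degenerations lower the ranks of powers -/

theorem Matrix.rank_le_card_of_row_eq_zero {m n ι k : Type*} [Field k] [Fintype m] [Fintype n]
    [Fintype ι] (A : Matrix m n k) (e : ι → m) (he : ∀ i, i ∉ Set.range e → A i = 0) :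
    A.rank ≤ Fintype.card ι := by
  rw [Matrix.rank_eq_finrank_span_row]
  refine le_trans (Submodule.finrank_mono (Submodule.span_le.2 ?_))
    (finrank_range_le_card (R := k) fun x => A.row (e x))
  rintro _ ⟨i, rfl⟩
  by_cases hi : i ∈ Set.range e
  · obtain ⟨x, rfl⟩ := hi
    exact Submodule.subset_span ⟨x, rfl⟩
  · exact (show A.row i = 0 from he i hi) ▸ Submodule.zero_mem _

theorem rank_jordanMatrix_pow_le (k : Type*) [Field k] {n : ℕ} (α : n.Partition) (m : ℕ) :
    (jordanMatrix k α ^ m).rank ≤ ∑ l : Fin n, (partitionPart α l - m) := by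
  have h := Matrix.rank_le_card_of_row_eq_zero (jordanMatrix k α ^ m)
    (fun x : Σ l : Fin n, Fin (partitionPart α l - m) =>
      jordanIndex α ⟨x.1, x.2, by omega⟩) fun i hi => ?_
  · simpa using h
  obtain ⟨⟨l, a⟩, rfl⟩ := (jordanIndex α).surjective i
  funext j
  obtain ⟨⟨l', c⟩, rfl⟩ := (jordanIndex α).surjective j
  rw [jordanMatrix_pow_apply, if_neg]
  · rfl
  rintro ⟨rfl, hac⟩
  have := c.2
  simp only at hac
  exact hi ⟨⟨l, a, by omega⟩, rfl⟩

/-- The minor of `A ^ m` whose rows are the indices `(l, a)` and whose columns are the indices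
`(l, a + m)` of the Jordan matrix of type `β` is a polynomial in the entries of `A`. At that
Jordan matrix it is `1`, whereas it vanishes wherever the rank of `A ^ m` is too small. -/
theorem DegLE.sum_sub_le {k : Type*} [Field k] {n : ℕ} {α β : n.Partition} (h : DegLE k α β)
    (m : ℕ) : ∑ l : Fin n, (partitionPart β l - m) ≤ ∑ l : Fin n, (partitionPart α l - m) := by
  by_contra! hlt
  let ι := Σ l : Fin n, Fin (partitionPart β l - m)
  let r : ι → Fin n := fun x => jordanIndex β ⟨x.1, x.2, by omega⟩
  let c : ι → Fin n := fun x => jordanIndex β ⟨x.1, x.2 + m, by omega⟩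
  have hcard : Fintype.card ι = ∑ l : Fin n, (partitionPart β l - m) := by simp [ι]
  set p : MvPolynomial (Fin n × Fin n) k :=
    ((Matrix.mvPolynomialX (Fin n) (Fin n) k ^ m).submatrix r c).det with hp
  have heval : ∀ B : Matrix (Fin n) (Fin n) k,
      MvPolynomial.eval (fun x => B x.1 x.2) p = ((B ^ m).submatrix r c).det := by
    intro B
    rw [hp, RingHom.map_det, RingHom.mapMatrix_apply, ← Matrix.submatrix_map,
      ← RingHom.mapMatrix_apply, map_pow, Matrix.mvPolynomialX_mapMatrix_eval]
  have hβ : (⟨jordanMatrix k β, isNilpotent_jordanMatrix k β⟩ : NilpotentMatrix k n) ∈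
      closure (nilpotentOrbit k α) := h (MulAction.mem_orbit_self _)
  have h0 := mem_closure_nilpotentMatrix_iff.1 hβ p fun B hB => ?_
  · rw [heval] at h0
    have hone : (jordanMatrix k β ^ m).submatrix r c = 1 := by
      ext x y
      rw [Matrix.submatrix_apply, jordanMatrix_pow_apply, Matrix.one_apply]
      obtain ⟨l, a⟩ := x
      obtain ⟨l', a'⟩ := y
      rcases eq_or_ne l l' with rfl | hl
      · simp [ι, Fin.ext_iff]
      · simp [ι, hl]
    rw [hone, Matrix.det_one] at h0
    exact one_ne_zero h0
  · rw [heval]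
    obtain ⟨g, hg⟩ := mem_nilpotentOrbit_iff.1 hB
    by_contra hdet
    have hrank := Matrix.rank_of_isUnit _ ((Matrix.isUnit_iff_isUnit_det _).2
      (isUnit_iff_ne_zero.2 hdet))
    have h1 := Matrix.rank_submatrix_le (B.1 ^ m) r c
    have h2 : (B.1 ^ m).rank ≤ (jordanMatrix k α ^ m).rank := by
      rw [← hg, Units.conj_pow]
      exact (Matrix.rank_mul_le_left _ _).trans (Matrix.rank_mul_le_right _ _)
    have h3 := rank_jordanMatrix_pow_le k α m
    omega

/-! ### Degenerations and box moves -/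

theorem mainTheorem8 (k : Type*) [Field k] [IsAlgClosed k] (n : ℕ) (α β : n.Partition) :
    DegLE k α β ↔ BoxLE α β := by
  have : Infinite k := inferInstance
  exact ⟨fun h => (dominates_of_sum_sub_le h.sum_sub_le).boxLE, fun h => h.degLE k⟩
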